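/- Let $\mathfrak{o}$ be a Dedekind domain which is not a field, $K$ its field of fractions, $L/K$ an algebraic (possibly infinite) field extension, and $\mathfrak{O}$ the integral closure of $\mathfrak{o}$ in $L$. For each maximal ideal $\mathfrak{P}$ of $\mathfrak{O}$ let $v_{\mathfrak{P}} \colon L^\times \to \mathbb{Q}$ be the unique additive valuation whose valuation ring is the localization $\mathfrak{O}_{\mathfrak{P}}$, normalized by $v_{\mathfrak{P}}(K^\times)=\mathbb{Z}$, and let $V_{\mathfrak{P}}$ be the closure of $v_{\mathfrak{P}}(L^\times)$ in $\mathbb{R}$. A fractional ideal of $\mathfrak{O}$ is a nonzero $\mathfrak{O}$-submodule $I$ of $L$ such that $dI\subseteq\mathfrak{O}$ for some $d\in L^\times$. Let $\mathcal{F}(\mathfrak{O})$, $\mathcal{I}(\mathfrak{O})$ and $\mathcal{P}(\mathfrak{O})$ be the multiplicative monoids of fractional, invertible fractional and principal fractional ideals $a\mathfrak{O}$ ($a\in L^\times$), and put $\mathrm{Cl}(\mathfrak{O})=\mathcal{F}(\mathfrak{O})/\mathcal{P}(\mathfrak{O})$ and $\mathrm{Pic}(\mathfrak{O})=\mathcal{I}(\mathfrak{O})/\mathcal{P}(\mathfrak{O})$.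 For a monoid $M$ let $\mathrm{Reg}\,M=\{a\in M : a=aba \text{ for some } b\in M\}$ be the set of its von Neumann regular elements. If $V_{\mathfrak{P}}=v_{\mathfrak{P}}(L^\times)$ for every maximal ideal $\mathfrak{P}$ of $\mathfrak{O}$ (equivalently, every value group $v_{\mathfrak{P}}(L^\times)$ is discrete in $\mathbb{R}$), then $$\mathrm{Reg}\,\mathrm{Cl}(\mathfrak{O})=\mathrm{Pic}(\mathfrak{O}),$$ that is, the canonical homomorphism $\mathrm{Pic}(\mathfrak{O})\to\mathrm{Cl}(\mathfrak{O})$, $[I]\mapsto[I]$, is injective with image $\mathrm{Reg}\,\mathrm{Cl}(\mathfrak{O})$. -/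

import Mathlib

open nonZeroDivisors

/-! ### Regular elements, fractional ideals, and the ideal class semigroup -/

/-- The set `Reg M` of von Neumann regular elements of a monoid `M`. -/
def regularPart (M : Type*) [Monoid M] : Set M :=
  {a | ∃ b, a = a * b * a}

section IdealClasses

variable (R L : Type*) [CommRing R] [IsDomain R] [Field L] [Algebra R L]

/-- The multiplicative monoid of nonzero fractional ideals of `R` in `L`. -/
def nonzeroFractionalIdeals : Submonoid (FractionalIdeal R⁰ L) where
  carrier := {I | I ≠ 0}
  one_mem' := one_ne_zero
  mul_mem' := by
    intro I J hI hJ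
    obtain ⟨x, hx, hx0⟩ : ∃ x ∈ I, x ≠ 0 := by
      by_contra! h
      exact hI ((FractionalIdeal.eq_zero_iff).2 h)
    obtain ⟨y, hy, hy0⟩ : ∃ y ∈ J, y ≠ 0 := by
      by_contra! h
      exact hJ ((FractionalIdeal.eq_zero_iff).2 h)
    intro h
    exact mul_ne_zero hx0 hy0
      ((FractionalIdeal.eq_zero_iff).1 h _ (FractionalIdeal.mul_mem_mul hx hy))

/-- The group of principal fractional ideals `x R`, `x ∈ Lˣ`, inside the group
`(FractionalIdeal R⁰ L)ˣ` of invertible fractional ideals. -/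
def principalFractionalIdeals : Subgroup (FractionalIdeal R⁰ L)ˣ where
  carrier := {I | ∃ x : Lˣ,
    ((I : FractionalIdeal R⁰ L) : Submodule R L) = Submodule.span R {(x : L)}}
  one_mem' := ⟨1, by simp [Submodule.one_eq_span]⟩
  mul_mem' := by
    rintro I J ⟨x, hx⟩ ⟨y, hy⟩
    exact ⟨x * y, by simp [hx, hy, Submodule.span_mul_span]⟩
  inv_mem' := by
    rintro I ⟨x, hx⟩
    refine ⟨x⁻¹, ?_⟩
    have h1 : ((I : FractionalIdeal R⁰ L) : Submodule R L) *
        ((I⁻¹ : (FractionalIdeal R⁰ L)ˣ) : FractionalIdeal R⁰ L) = 1 := by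
      rw [← FractionalIdeal.coe_mul, Units.mul_inv, FractionalIdeal.coe_one]
    have h2 : ((I : FractionalIdeal R⁰ L) : Submodule R L) *
        Submodule.span R {((x⁻¹ : Lˣ) : L)} = 1 := by
      rw [hx, Submodule.span_mul_span]
      simp [Submodule.one_eq_span]
    calc (((I⁻¹ : (FractionalIdeal R⁰ L)ˣ) : FractionalIdeal R⁰ L) : Submodule R L)
        = ((I⁻¹ : (FractionalIdeal R⁰ L)ˣ) : FractionalIdeal R⁰ L) *
          (((I : FractionalIdeal R⁰ L) : Submodule R L) *
            Submodule.span R {((x⁻¹ : Lˣ) : L)}) := by rw [h2, mul_one]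
      _ = Submodule.span R {((x⁻¹ : Lˣ) : L)} := by
          rw [mul_left_comm, ← mul_assoc, h1, one_mul]

/-- The congruence on nonzero fractional ideals given by multiplication by principal
fractional ideals. -/
def idealClassCon : Con (nonzeroFractionalIdeals R L) where
  r I J := ∃ u ∈ principalFractionalIdeals R L,
    (I : FractionalIdeal R⁰ L) = (u : FractionalIdeal R⁰ L) * J
  iseqv :=
    { refl := fun I => ⟨1, one_mem _, by simp⟩
      symm := by
        rintro I J ⟨u, hu, h⟩
        exact ⟨u⁻¹, inv_mem hu, by rw [h, ← mul_assoc, Units.inv_mul, one_mul]⟩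
      trans := by
        rintro I J K ⟨u, hu, h⟩ ⟨w, hw, h'⟩
        exact ⟨u * w, mul_mem hu hw, by rw [h, h', Units.val_mul, mul_assoc]⟩ }
  mul' := by
    rintro I I' J J' ⟨u, hu, h⟩ ⟨w, hw, h'⟩
    refine ⟨u * w, mul_mem hu hw, ?_⟩
    rw [Submonoid.coe_mul, Submonoid.coe_mul, h, h', Units.val_mul, mul_mul_mul_comm]

/-- The ideal class semigroup `Cl R`: nonzero fractional ideals modulo principal ones. -/
abbrev IdealClassSemigroup : Type _ := (idealClassCon R L).Quotient

/-- The Picard group `Pic R`: invertible fractional ideals modulo principal ones. -/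
abbrev PicardGroup : Type _ := (FractionalIdeal R⁰ L)ˣ ⧸ principalFractionalIdeals R L

/-- An invertible fractional ideal, as a nonzero fractional ideal. -/
def unitsToNonzero : (FractionalIdeal R⁰ L)ˣ →* nonzeroFractionalIdeals R L where
  toFun u := ⟨u, u.ne_zero⟩
  map_one' := rfl
  map_mul' _ _ := rfl

/-- The canonical homomorphism `Pic R → Cl R`, sending the class of an invertible fractional
ideal to its class. -/
def picardToClass : PicardGroup R L →* IdealClassSemigroup R L :=
  QuotientGroup.lift (principalFractionalIdeals R L)
    ((idealClassCon R L).mk'.comp (unitsToNonzero R L)) (by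
      intro u hu
      exact (Con.eq _).2 ⟨u, hu, by simp [unitsToNonzero]⟩)

end IdealClasses

/-! ### The normalized valuation attached to a maximal ideal -/

section Valuation

variable (𝔬 K L : Type*) [CommRing 𝔬] [IsDedekindDomain 𝔬] [Field K] [Algebra 𝔬 K]
  [IsFractionRing 𝔬 K] [Field L] [Algebra K L] [Algebra 𝔬 L] [IsScalarTower 𝔬 K L]

variable {𝔬 L} in
/-- `v` is the additive valuation of `L` that corresponds to the maximal ideal `P` of the integral
closure `𝔒` of `𝔬` in `L` (its valuation ring is the localization of `𝔒` at `P`), normalized by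
`v (Kˣ) = ℤ`. -/
structure IsNormalizedValuation (P : MaximalSpectrum (integralClosure 𝔬 L))
    (v : AddValuation L (WithTop ℚ)) : Prop where
  nonneg_iff : ∀ x : L, 0 ≤ v x ↔
    ∃ a s : integralClosure 𝔬 L, s ∉ P.asIdeal ∧ x * (s : L) = (a : L)
  values : {q : ℚ | ∃ a : K, v (algebraMap K L a) = (q : WithTop ℚ)} = Set.range ((↑) : ℤ → ℚ)

/-- A root of a polynomial with a unit coefficient over an integrally closed local ring
lies in the ring or has its inverse there. -/
theorem mem_or_inv_mem_of_isUnit_coeff {R F : Type*} [CommRing R] [IsLocalRing R] [Field F]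
    [Algebra R F] (hic : ∀ x : F, IsIntegral R x → ∃ r, algebraMap R F r = x) (u : F) :
    ∀ (n : ℕ) (f : Polynomial R), f.natDegree ≤ n → Polynomial.aeval u f = 0 →
      (∃ j, IsUnit (f.coeff j)) →
      (∃ r, algebraMap R F r = u) ∨ ∃ r, algebraMap R F r * u = 1 := by
  intro n
  induction n with
  | zero =>
    rintro f hf h0 ⟨j, hj⟩
    rw [Polynomial.eq_C_of_natDegree_le_zero hf] at h0 hj
    rw [Polynomial.coeff_C] at hj
    rw [Polynomial.aeval_C] at h0
    split_ifs at hj with hj0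
    · exact absurd h0 (hj.map (algebraMap R F)).ne_zero
    · exact absurd hj not_isUnit_zero
  | succ n ih =>
    rintro f hf h0 ⟨j, hj⟩
    by_cases hd : f.natDegree ≤ n
    · exact ih f hd h0 ⟨j, hj⟩
    have hd' : f.natDegree = n + 1 := by omega
    obtain ⟨b, hb⟩ := hic _ (isIntegral_leadingCoeff_smul f u h0)
    rw [Algebra.smul_def] at hb
    set a := f.leadingCoeff with ha
    have hdec : f = f.eraseLead + Polynomial.C a * Polynomial.X ^ (n + 1) := by
      conv_lhs => rw [← Polynomial.eraseLead_add_C_mul_X_pow f, hd']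
    let g := f.eraseLead + Polynomial.C b * Polynomial.X ^ n
    have hg0 : Polynomial.aeval u g = 0 := by
      rw [hdec] at h0
      simp only [g, map_add, map_mul, map_pow, Polynomial.aeval_C, Polynomial.aeval_X] at h0 ⊢
      rw [hb]
      linear_combination h0
    have hgd : g.natDegree ≤ n := by
      refine Polynomial.natDegree_add_le_of_degree_le ?_ (Polynomial.natDegree_C_mul_X_pow_le _ _)
      have := Polynomial.eraseLead_natDegree_le f
      omega
    have hgc : ∀ i, i ≤ n → g.coeff i = f.coeff i + if i = n then b else 0 := by
      intro i hi
      simp only [g, Polynomial.coeff_add, Polynomial.coeff_C_mul, Polynomial.coeff_X_pow]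
      rw [Polynomial.eraseLead_coeff_of_ne _ (by omega)]
      split_ifs <;> simp
    rcases lt_trichotomy j n with hjn | hjn | hjn
    · exact ih g hgd hg0 ⟨j, by rw [hgc j hjn.le, if_neg hjn.ne, add_zero]; exact hj⟩
    · subst hjn
      have hsum : IsUnit ((f.coeff j + b) + (-b)) := by simpa using hj
      rcases IsLocalRing.isUnit_or_isUnit_of_isUnit_add hsum with h | h
      · exact ih g hgd hg0 ⟨j, by rw [hgc j le_rfl, if_pos rfl]; exact h⟩
      · obtain ⟨c, hc⟩ := ((IsUnit.neg_iff b).1 h).exists_left_inv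
        refine Or.inr ⟨c * a, ?_⟩
        rw [map_mul, mul_assoc, ← hb, ← map_mul, hc, map_one]
    · have hjn1 : j = n + 1 := by
        by_contra hne
        rw [Polynomial.coeff_eq_zero_of_natDegree_lt (by omega)] at hj
        exact not_isUnit_zero hj
      have hau : IsUnit a := by
        rw [ha, Polynomial.leadingCoeff, hd', ← hjn1]; exact hj
      obtain ⟨c, hc⟩ := hau.exists_left_inv
      refine Or.inl ⟨c * b, ?_⟩
      rw [map_mul, hb, ← mul_assoc, ← map_mul, hc, map_one, one_mul]

variable {𝔬 L} in
/-- The nonzero prime of `𝔬` below a maximal ideal of the integral closure. -/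
def primeBelow (h𝔬 : ¬ IsField 𝔬) (P : MaximalSpectrum (integralClosure 𝔬 L)) :
    IsDedekindDomain.HeightOneSpectrum 𝔬 where
  asIdeal := P.asIdeal.comap (algebraMap 𝔬 (integralClosure 𝔬 L))
  isPrime := by
    have := P.isMaximal
    infer_instance
  ne_bot := by
    intro h
    have := P.isMaximal
    have hm : (P.asIdeal.comap (algebraMap 𝔬 (integralClosure 𝔬 L))).IsMaximal :=
      Ideal.isMaximal_comap_of_isIntegral_of_isMaximal P.asIdeal
    rw [h] at hm
    exact Ring.ne_bot_of_isMaximal_of_not_isField hm h𝔬 rfl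

variable {𝔬 L} in
/-- The localization of the integral closure at a maximal ideal is a valuation ring of `L`. -/
theorem exists_valuationSubring [Algebra.IsAlgebraic K L] (h𝔬 : ¬ IsField 𝔬)
    (P : MaximalSpectrum (integralClosure 𝔬 L)) :
    ∃ A : ValuationSubring L, ∀ x : L, x ∈ A ↔
      ∃ a s : integralClosure 𝔬 L, s ∉ P.asIdeal ∧ x * (s : L) = (a : L) := by
  have hPm := P.isMaximal
  have hPp : P.asIdeal.IsPrime := hPm.isPrime
  let B : Subring L := (integralClosure 𝔬 L).toSubring
  let Q : Ideal B := P.asIdeal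
  have hQ : Q.IsPrime := hPp
  let R : Subring L := (LocalSubring.ofPrime B Q).toSubring
  have hRmem : ∀ x : L, x ∈ R ↔
      ∃ a s : integralClosure 𝔬 L, s ∉ P.asIdeal ∧ x * (s : L) = (a : L) := by
    intro x
    constructor
    · intro hx
      obtain ⟨⟨a, s⟩, h⟩ := IsLocalization.surj (M := Q.primeCompl) (⟨x, hx⟩ : R)
      exact ⟨a, s.1, s.2, congrArg Subtype.val h⟩
    · rintro ⟨a, s, hs, h⟩
      have hs' : (s : L) ≠ 0 := by
        intro h0
        exact hs (by rw [show s = 0 from Subtype.ext h0]; exact zero_mem _)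
      obtain ⟨r, hr⟩ := (IsLocalization.map_units R (⟨s, hs⟩ : Q.primeCompl)).exists_left_inv
      have hr' : (r : L) * (s : L) = 1 := congrArg Subtype.val hr
      have : x = (r : L) * (a : L) := by
        rw [← h]; linear_combination (-x) * hr'
      rw [this]
      exact mul_mem r.2 (LocalSubring.le_ofPrime B Q a.2)
  have hint : ∀ x : L, IsIntegral R x → ∃ r, algebraMap R L r = x := by
    intro x hx
    obtain ⟨⟨m, hm⟩, hmx⟩ := IsIntegral.exists_multiple_integral_of_isLocalization Q.primeCompl x hx
    have hmx' : IsIntegral (integralClosure 𝔬 L) ((m : L) * x) := hmx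
    have h2 : (m : L) * x ∈ integralClosure 𝔬 L := isIntegral_trans _ hmx'
    exact ⟨⟨x, (hRmem x).2 ⟨⟨_, h2⟩, m, hm, mul_comm _ _⟩⟩, rfl⟩
  let p := primeBelow h𝔬 P
  have hK : ∀ c : K, p.valuation K c ≤ 1 → algebraMap K L c ∈ R := by
    intro c hc
    obtain ⟨a, s, hsa⟩ := p.exists_primeCompl_mul_eq_of_integer c hc
    refine (hRmem _).2 ⟨algebraMap 𝔬 _ a, algebraMap 𝔬 _ s, s.2, ?_⟩
    have := congrArg (algebraMap K L) hsa
    simpa [Algebra.smul_def, ← IsScalarTower.algebraMap_apply, mul_comm] using this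
  refine ⟨ValuationSubring.ofSubring R ?_, fun x => hRmem x⟩
  intro x
  obtain ⟨f, hf0, hfx⟩ := Algebra.IsAlgebraic.isAlgebraic (R := K) x
  obtain ⟨j, hj, hmax⟩ := Finset.exists_max_image f.support (fun i => p.valuation K (f.coeff i))
    (Polynomial.support_nonempty.2 hf0)
  have hj0 : f.coeff j ≠ 0 := Polynomial.mem_support_iff.1 hj
  let f' : Polynomial L := (Polynomial.C (f.coeff j)⁻¹ * f).map (algebraMap K L)
  have hf'c : ∀ i, f'.coeff i = algebraMap K L ((f.coeff j)⁻¹ * f.coeff i) := by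
    intro i; simp [f']
  have hf'R : (f'.coeffs : Set L) ⊆ R := by
    intro y hy
    obtain ⟨i, -, rfl⟩ := Polynomial.mem_coeffs_iff.1 hy
    rw [hf'c]
    refine hK _ ?_
    by_cases hi : i ∈ f.support
    · rw [map_mul, map_inv₀]
      exact inv_mul_le_one_of_le₀ (hmax i hi) zero_le
    · rw [Polynomial.notMem_support_iff.1 hi]; simp
  have key := mem_or_inv_mem_of_isUnit_coeff hint x _ (f'.toSubring R hf'R) le_rfl
    (by
      have h1 : (f'.toSubring R hf'R).map (algebraMap R L) = f' :=
        Polynomial.map_toSubring f' R hf'R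
      rw [← Polynomial.aeval_map_algebraMap L, h1]
      have : Polynomial.aeval x f' = Polynomial.aeval x (Polynomial.C (f.coeff j)⁻¹ * f) :=
        Polynomial.aeval_map_algebraMap _ _ _
      rw [this, map_mul, hfx, mul_zero])
    ⟨j, by
      have : (f'.toSubring R hf'R).coeff j = 1 := by
        apply Subtype.ext
        rw [Polynomial.coeff_toSubring, hf'c, inv_mul_cancel₀ hj0, map_one]
        rfl
      rw [this]; exact isUnit_one⟩
  rcases key with ⟨r, hr⟩ | ⟨r, hr⟩
  · left; rw [← hr]; exact r.2
  · right
    rw [← eq_inv_of_mul_eq_one_left hr]; exact r.2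

variable {K L} in
/-- Values on an algebraic extension are torsion modulo the values on the base field. -/
theorem exists_pow_valuation_eq [Algebra.IsAlgebraic K L] {Γ : Type*}
    [LinearOrderedCommGroupWithZero Γ] (w : Valuation L Γ) (x : L) (hx : x ≠ 0) :
    ∃ n : ℕ, 0 < n ∧ ∃ a : K, a ≠ 0 ∧ w x ^ n = w (algebraMap K L a) := by
  obtain ⟨f, hf0, hfx⟩ := Algebra.IsAlgebraic.isAlgebraic (R := K) x
  let t : ℕ → L := fun i => algebraMap K L (f.coeff i) * x ^ i
  obtain ⟨j, hj, hmax⟩ := Finset.exists_max_image f.support (fun i => w (t i))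
    (Polynomial.support_nonempty.2 hf0)
  have ht : ∀ i ∈ f.support, w (t i) ≠ 0 := by
    intro i hi
    refine (Valuation.ne_zero_iff w).2 (mul_ne_zero ?_ (pow_ne_zero _ hx))
    exact (map_ne_zero _).2 (Polynomial.mem_support_iff.1 hi)
  have hsum : ∑ i ∈ f.support, t i = 0 := by
    rw [Polynomial.aeval_def, Polynomial.eval₂_eq_sum, Polynomial.sum_def] at hfx
    exact hfx
  obtain ⟨i, hi, hij, heq⟩ : ∃ i ∈ f.support, i ≠ j ∧ w (t i) = w (t j) := by
    by_contra! hne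
    have hlt : w (∑ i ∈ f.support.erase j, t i) < w (t j) := by
      refine Valuation.map_sum_lt w (ht j hj) ?_
      intro i hi
      rw [Finset.mem_erase] at hi
      exact lt_of_le_of_ne (hmax i hi.2) (hne i hi.2 hi.1)
    rw [← Finset.add_sum_erase _ _ hj] at hsum
    rw [eq_neg_of_add_eq_zero_right hsum, Valuation.map_neg] at hlt
    exact lt_irrefl _ hlt
  have main : ∀ i j : ℕ, i ∈ f.support → j ∈ f.support → i < j → w (t i) = w (t j) →
      ∃ n : ℕ, 0 < n ∧ ∃ a : K, a ≠ 0 ∧ w x ^ n = w (algebraMap K L a) := by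
    intro i j hi hj hlt heq
    have hi0 := Polynomial.mem_support_iff.1 hi
    have hj0 := Polynomial.mem_support_iff.1 hj
    refine ⟨j - i, by omega, f.coeff i / f.coeff j, div_ne_zero hi0 hj0, ?_⟩
    have hwj : w (algebraMap K L (f.coeff j)) ≠ 0 :=
      (Valuation.ne_zero_iff w).2 ((map_ne_zero _).2 hj0)
    have hwx : w x ^ i ≠ 0 := pow_ne_zero _ ((Valuation.ne_zero_iff w).2 hx)
    simp only [t, map_mul, map_pow] at heq
    rw [map_div₀, map_div₀, eq_div_iff hwj]
    apply mul_right_cancel₀ hwx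
    rw [heq, mul_right_comm, ← pow_add, Nat.sub_add_cancel hlt.le, mul_comm]
  rcases lt_or_gt_of_ne hij with h | h
  · exact main i j hi hj h heq
  · exact main j i hj hi h heq.symm

variable {𝔬 L} in
/-- The normalized valuation attached to a maximal ideal exists. -/
theorem exists_isNormalizedValuation [Algebra.IsAlgebraic K L] (h𝔬 : ¬ IsField 𝔬)
    (P : MaximalSpectrum (integralClosure 𝔬 L)) :
    ∃ v : AddValuation L (WithTop ℚ), IsNormalizedValuation K P v := by
  obtain ⟨A, hA⟩ := exists_valuationSubring K h𝔬 P
  have hPp : P.asIdeal.IsPrime := P.isMaximal.isPrime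
  let w := A.valuation
  let p := primeBelow h𝔬 P
  let u := p.valuation K
  have hle1 : ∀ c : K, w (algebraMap K L c) ≤ 1 ↔ u c ≤ 1 := by
    intro c
    rw [A.valuation_le_one_iff, hA]
    constructor
    · rintro ⟨a, s, hs, h⟩
      by_contra! hc
      have hc0 : c ≠ 0 := by
        rintro rfl
        simp at hc
      have hc' : u c⁻¹ ≤ 1 := by
        rw [map_inv₀]; exact inv_le_one_of_one_le₀ hc.le
      obtain ⟨b, t, hbt⟩ := p.exists_primeCompl_mul_eq_of_integer _ hc'
      have hb : b ∈ p.asIdeal := by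
        refine (p.valuation_lt_one_iff_mem (K := K) b).1 ?_
        change p.valuation K (algebraMap 𝔬 K b) < 1
        rw [← hbt, map_mul]
        have h1 : p.valuation K (algebraMap 𝔬 K t) = 1 := p.valuation_eq_one_iff_notMem.2 t.2
        rw [h1, mul_one, map_inv₀]
        exact inv_lt_one_of_one_lt₀ hc
      have hb' : algebraMap 𝔬 (integralClosure 𝔬 L) b ∈ P.asIdeal := hb
      have ht' : algebraMap 𝔬 (integralClosure 𝔬 L) t ∉ P.asIdeal := t.2
      have hc1 : algebraMap K L c ≠ 0 := (map_ne_zero _).2 hc0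
      have h2 : (algebraMap K L c)⁻¹ * algebraMap 𝔬 L t = algebraMap 𝔬 L b := by
        have := congrArg (algebraMap K L) hbt
        simpa [← IsScalarTower.algebraMap_apply] using this
      have h3 : algebraMap 𝔬 (integralClosure 𝔬 L) t * s =
          algebraMap 𝔬 (integralClosure 𝔬 L) b * a := by
        apply Subtype.ext
        change algebraMap 𝔬 L t * (s : L) = algebraMap 𝔬 L b * (a : L)
        rw [← h, ← h2]
        field_simp
      have h4 : algebraMap 𝔬 (integralClosure 𝔬 L) t * s ∈ P.asIdeal := by
        rw [h3]; exact Ideal.mul_mem_right _ _ hb'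
      exact (hPp.mem_or_mem h4).elim ht' hs
    · intro hc
      obtain ⟨a, s, hsa⟩ := p.exists_primeCompl_mul_eq_of_integer c hc
      refine ⟨algebraMap 𝔬 _ a, algebraMap 𝔬 _ s, s.2, ?_⟩
      have := congrArg (algebraMap K L) hsa
      simpa [← IsScalarTower.algebraMap_apply] using this
  have hle : ∀ a b : K, w (algebraMap K L a) ≤ w (algebraMap K L b) ↔ u a ≤ u b := by
    have : (w.comap (algebraMap K L)).IsEquiv u := Valuation.isEquiv_of_val_le_one (fun {c} => hle1 c)
    exact this
  let o : K → ℤ := fun a => -(WithZero.log (u a))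
  have hu0 : ∀ a : K, a ≠ 0 → u a ≠ 0 := fun a ha => (Valuation.ne_zero_iff u).2 ha
  have ho_le : ∀ a b : K, a ≠ 0 → b ≠ 0 → (u a ≤ u b ↔ o b ≤ o a) := by
    intro a b ha hb
    rw [← WithZero.log_le_log (hu0 a ha) (hu0 b hb)]
    simp [o]
  have ho_mul : ∀ a b : K, a ≠ 0 → b ≠ 0 → o (a * b) = o a + o b := by
    intro a b ha hb
    simp only [o, map_mul, WithZero.log_mul (hu0 a ha) (hu0 b hb)]
    ring
  have ho_pow : ∀ (a : K) (n : ℕ), o (a ^ n) = n * o a := by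
    intro a n
    simp [o, WithZero.log_pow]
  let D : L → ℚ → Prop := fun x q =>
    ∃ n : ℕ, 0 < n ∧ ∃ a : K, a ≠ 0 ∧ w x ^ n = w (algebraMap K L a) ∧ q = (o a : ℚ) / n
  have hDle : ∀ x y q r, D x q → D y r → (w x ≤ w y ↔ r ≤ q) := by
    rintro x y q r ⟨n, hn, a, ha, hxa, rfl⟩ ⟨m, hm, b, hb, hyb, rfl⟩
    have h1 : w x ^ (n * m) = w (algebraMap K L (a ^ m)) := by
      rw [pow_mul, hxa, map_pow, map_pow]
    have h2 : w y ^ (n * m) = w (algebraMap K L (b ^ n)) := by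
      rw [mul_comm, pow_mul, hyb, map_pow, map_pow]
    have hn' : (0 : ℚ) < n := by exact_mod_cast hn
    have hm' : (0 : ℚ) < m := by exact_mod_cast hm
    rw [← pow_le_pow_iff_left₀ zero_le zero_le (Nat.mul_pos hn hm).ne', h1, h2, hle,
      ho_le _ _ (pow_ne_zero _ ha) (pow_ne_zero _ hb), ho_pow, ho_pow, div_le_div_iff₀ hm' hn']
    rw [← Int.cast_le (R := ℚ)]
    push_cast
    rw [mul_comm (n : ℚ), mul_comm (m : ℚ)]
  have hDuniq : ∀ x q r, D x q → D x r → q = r := fun x q r h h' =>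
    le_antisymm ((hDle x x r q h' h).1 le_rfl) ((hDle x x q r h h').1 le_rfl)
  have hDmul : ∀ x y q r, D x q → D y r → D (x * y) (q + r) := by
    rintro x y q r ⟨n, hn, a, ha, hxa, rfl⟩ ⟨m, hm, b, hb, hyb, rfl⟩
    refine ⟨n * m, Nat.mul_pos hn hm, a ^ m * b ^ n,
      mul_ne_zero (pow_ne_zero _ ha) (pow_ne_zero _ hb), ?_, ?_⟩
    · rw [map_mul, mul_pow, pow_mul, hxa, mul_comm n m, pow_mul (w y), hyb]
      simp
    · rw [ho_mul _ _ (pow_ne_zero _ ha) (pow_ne_zero _ hb), ho_pow, ho_pow]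
      have hn' : (n : ℚ) ≠ 0 := by exact_mod_cast hn.ne'
      have hm' : (m : ℚ) ≠ 0 := by exact_mod_cast hm.ne'
      push_cast
      field_simp
  have hDK : ∀ a : K, a ≠ 0 → D (algebraMap K L a) (o a) := fun a ha =>
    ⟨1, one_pos, a, ha, by simp, by simp⟩
  have hD1 : D 1 0 := by
    have h1 := hDK 1 one_ne_zero
    rw [map_one] at h1
    have h2 := hDmul _ _ _ _ h1 h1
    rw [one_mul] at h2
    have h3 := hDuniq _ _ _ h1 h2
    have h4 : ((o 1 : ℤ) : ℚ) = 0 := by linarith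
    rwa [h4] at h1
  have hDex : ∀ x : L, ∃ q : ℚ, x ≠ 0 → D x q := by
    intro x
    by_cases hx : x = 0
    · exact ⟨0, fun h => absurd hx h⟩
    · obtain ⟨n, hn, a, ha, h⟩ := exists_pow_valuation_eq (K := K) w x hx
      exact ⟨_, fun _ => ⟨n, hn, a, ha, h, rfl⟩⟩
  choose q hq using hDex
  classical
  let f : L → WithTop ℚ := fun x => if x = 0 then ⊤ else (q x : WithTop ℚ)
  have f0 : f 0 = ⊤ := if_pos rfl
  have fn : ∀ x, x ≠ 0 → f x = (q x : WithTop ℚ) := fun x hx => if_neg hx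
  have fD : ∀ x r, x ≠ 0 → D x r → f x = (r : WithTop ℚ) := fun x r hx h => by
    rw [fn x hx, hDuniq x _ _ (hq x hx) h]
  let v : AddValuation L (WithTop ℚ) := AddValuation.of f f0 (fD 1 0 one_ne_zero hD1)
    (by
      intro x y
      by_cases hx : x = 0
      · subst hx; simp
      by_cases hy : y = 0
      · subst hy; simp
      by_cases hxy : x + y = 0
      · rw [hxy, f0]; exact le_top
      rw [fn x hx, fn y hy, fn _ hxy]
      rcases Valuation.map_add' w x y with h | h
      · exact (min_le_left _ _).trans
          (WithTop.coe_le_coe.2 ((hDle _ _ _ _ (hq _ hxy) (hq x hx)).1 h))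
      · exact (min_le_right _ _).trans
          (WithTop.coe_le_coe.2 ((hDle _ _ _ _ (hq _ hxy) (hq y hy)).1 h)))
    (by
      intro x y
      by_cases hx : x = 0
      · subst hx; rw [zero_mul, f0, top_add]
      by_cases hy : y = 0
      · subst hy; rw [mul_zero, f0, add_top]
      rw [fD _ _ (mul_ne_zero hx hy) (hDmul _ _ _ _ (hq x hx) (hq y hy)), fn x hx, fn y hy,
        WithTop.coe_add])
  refine ⟨v, ⟨?_, ?_⟩⟩
  · intro x
    rw [← hA, ← A.valuation_le_one_iff]
    change 0 ≤ f x ↔ w x ≤ 1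
    by_cases hx : x = 0
    · subst hx; simp [f0]
    · rw [fn x hx, ← map_one w, hDle _ _ _ _ (hq x hx) hD1]
      exact WithTop.coe_le_coe
  · ext r
    constructor
    · rintro ⟨a, ha⟩
      change f _ = _ at ha
      by_cases ha0 : a = 0
      · subst ha0; rw [map_zero, f0] at ha; exact absurd ha WithTop.top_ne_coe
      · rw [fD _ _ ((map_ne_zero _).2 ha0) (hDK a ha0)] at ha
        exact ⟨o a, WithTop.coe_injective ha⟩
    · rintro ⟨z, rfl⟩
      obtain ⟨a, ha⟩ := p.valuation_surjective K (WithZero.exp (-z))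
      have ha0 : a ≠ 0 := by
        rintro rfl
        rw [map_zero] at ha
        exact WithZero.exp_ne_zero ha.symm
      refine ⟨a, ?_⟩
      change f _ = _
      rw [fD _ _ ((map_ne_zero _).2 ha0) (hDK a ha0)]
      have : o a = z := by
        change -(WithZero.log (p.valuation K a)) = z
        rw [ha, WithZero.log_exp, neg_neg]
      rw [this]

variable {𝔬 K L} in
/-- The normalized valuation attached to a maximal ideal is unique. -/
theorem IsNormalizedValuation.unique {P : MaximalSpectrum (integralClosure 𝔬 L)}
    {v v' : AddValuation L (WithTop ℚ)} (hv : IsNormalizedValuation K P v)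
    (hv' : IsNormalizedValuation K P v') : v = v' := by
  have hcoe : ∀ (v : AddValuation L (WithTop ℚ)) (x : L), x ≠ 0 →
      ∃ q : ℚ, v x = (q : WithTop ℚ) := by
    intro v x hx
    exact ⟨_, (WithTop.coe_untop _ (v.ne_top_iff.2 hx)).symm⟩
  choose q hq using hcoe v
  choose q' hq' using hcoe v'
  have hmul : ∀ x y (hx : x ≠ 0) (hy : y ≠ 0),
      q (x * y) (mul_ne_zero hx hy) = q x hx + q y hy := by
    intro x y hx hy
    apply WithTop.coe_injective
    rw [← hq, v.map_mul, hq x hx, hq y hy, WithTop.coe_add]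
  have hmul' : ∀ x y (hx : x ≠ 0) (hy : y ≠ 0),
      q' (x * y) (mul_ne_zero hx hy) = q' x hx + q' y hy := by
    intro x y hx hy
    apply WithTop.coe_injective
    rw [← hq', v'.map_mul, hq' x hx, hq' y hy, WithTop.coe_add]
  have hpow : ∀ x (hx : x ≠ 0) (n : ℕ), q (x ^ n) (pow_ne_zero n hx) = n * q x hx := by
    intro x hx n
    apply WithTop.coe_injective
    rw [← hq, v.map_pow, hq x hx, ← WithTop.coe_nsmul, nsmul_eq_mul]
  have hpow' : ∀ x (hx : x ≠ 0) (n : ℕ), q' (x ^ n) (pow_ne_zero n hx) = n * q' x hx := by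
    intro x hx n
    apply WithTop.coe_injective
    rw [← hq', v'.map_pow, hq' x hx, ← WithTop.coe_nsmul, nsmul_eq_mul]
  have hnn : ∀ x (hx : x ≠ 0), 0 ≤ q x hx ↔ 0 ≤ q' x hx := by
    intro x hx
    have h := (hv.nonneg_iff x).trans (hv'.nonneg_iff x).symm
    rw [hq x hx, hq' x hx] at h
    exact_mod_cast h
  have hle : ∀ x y (hx : x ≠ 0) (hy : y ≠ 0), q x hx ≤ q y hy ↔ q' x hx ≤ q' y hy := by
    intro x y hx hy
    have h1 := hmul (y / x) x (div_ne_zero hy hx) hx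
    have h2 := hmul' (y / x) x (div_ne_zero hy hx) hx
    have h3 := hnn (y / x) (div_ne_zero hy hx)
    simp only [div_mul_cancel₀ y hx] at h1 h2
    constructor
    · intro h; linarith [h3.1 (by linarith)]
    · intro h; linarith [h3.2 (by linarith)]
  have hzero : ∀ x (hx : x ≠ 0) y (hy : y ≠ 0), q x hx = q y hy → q' x hx = q' y hy := by
    intro x hx y hy h
    exact le_antisymm ((hle x y hx hy).1 h.le) ((hle y x hy hx).1 h.ge)
  have hone : ∀ (v : AddValuation L (WithTop ℚ)), IsNormalizedValuation K P v →
      ∃ a : K, a ≠ 0 ∧ v (algebraMap K L a) = ((1 : ℚ) : WithTop ℚ) := by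
    intro v hv
    have h1 : (1 : ℚ) ∈ {q : ℚ | ∃ a : K, v (algebraMap K L a) = (q : WithTop ℚ)} := by
      rw [hv.values]; exact ⟨1, by simp⟩
    obtain ⟨a, ha⟩ := h1
    refine ⟨a, ?_, ha⟩
    rintro rfl
    rw [map_zero, v.map_zero] at ha
    exact WithTop.top_ne_coe ha
  have hint : ∀ (v : AddValuation L (WithTop ℚ)), IsNormalizedValuation K P v →
      ∀ (a : K) (r : ℚ), v (algebraMap K L a) = (r : WithTop ℚ) → ∃ z : ℤ, (z : ℚ) = r := by
    intro v hv a r h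
    have : r ∈ {q : ℚ | ∃ a : K, v (algebraMap K L a) = (q : WithTop ℚ)} := ⟨a, h⟩
    rw [hv.values] at this
    exact this
  obtain ⟨π, hπ0, hπ⟩ := hone v hv
  obtain ⟨ρ, hρ0, hρ⟩ := hone v' hv'
  have hπL : algebraMap K L π ≠ 0 := (map_ne_zero _).2 hπ0
  have hρL : algebraMap K L ρ ≠ 0 := (map_ne_zero _).2 hρ0
  have hqπ : q _ hπL = 1 := WithTop.coe_injective ((hq _ hπL).symm.trans hπ)
  have hqρ : q' _ hρL = 1 := WithTop.coe_injective ((hq' _ hρL).symm.trans hρ)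
  obtain ⟨k, hk⟩ := hint v' hv' π _ (hq' _ hπL)
  obtain ⟨j, hj⟩ := hint v hv ρ _ (hq _ hρL)
  have hj0 : 0 ≤ j := by
    have := (hnn _ hρL).2 (by rw [hqρ]; norm_num)
    rw [← hj] at this
    exact_mod_cast this
  have hk0 : 0 ≤ k := by
    have := (hnn _ hπL).1 (by rw [hqπ]; norm_num)
    rw [← hk] at this
    exact_mod_cast this
  lift j to ℕ using hj0
  have hjk : (j : ℤ) * k = 1 := by
    have h := hzero _ hρL _ (pow_ne_zero j hπL) (by rw [hpow _ hπL, hqπ, ← hj]; simp)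
    rw [hpow' _ hπL, hqρ, ← hk] at h
    exact_mod_cast h.symm
  have hk1 : k = 1 := by
    have := Int.eq_one_or_neg_one_of_mul_eq_one' hjk
    omega
  have hqπ' : q' _ hπL = 1 := by rw [← hk, hk1]; simp
  apply AddValuation.ext
  intro x
  by_cases hx : x = 0
  · subst hx; rw [v.map_zero, v'.map_zero]
  rw [hq x hx, hq' x hx]
  congr 1
  set c := q x hx with hc
  have hden : (c.den : ℚ) ≠ 0 := by exact_mod_cast c.den_ne_zero
  have hnum : (c.den : ℚ) * c = c.num := by rw [mul_comm]; exact Rat.mul_den_eq_num c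
  rcases le_total 0 c.num with h | h
  · obtain ⟨m, hm⟩ := Int.eq_ofNat_of_zero_le h
    have h1 := hzero _ (pow_ne_zero c.den hx) _ (pow_ne_zero m hπL) (by
      rw [hpow x hx, hpow _ hπL, hqπ, ← hc, hnum, hm]; simp)
    rw [hpow' x hx, hpow' _ hπL, hqπ'] at h1
    apply mul_left_cancel₀ hden
    rw [hnum, h1, hm]; simp
  · obtain ⟨m, hm⟩ := Int.eq_ofNat_of_zero_le (neg_nonneg.2 h)
    have hm' : (c.num : ℚ) = -m := by
      have : c.num = -(m : ℤ) := by omega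
      rw [this]; simp
    have h1 := hzero _ (mul_ne_zero (pow_ne_zero c.den hx) (pow_ne_zero m hπL)) _
      (pow_ne_zero 0 hπL) (by
        rw [hmul _ _ (pow_ne_zero c.den hx) (pow_ne_zero m hπL), hpow x hx, hpow _ hπL,
          hpow _ hπL, hqπ, ← hc, hnum, hm']; simp)
    rw [hmul' _ _ (pow_ne_zero c.den hx) (pow_ne_zero m hπL), hpow' x hx, hpow' _ hπL,
      hpow' _ hπL, hqπ'] at h1
    apply mul_left_cancel₀ hden
    rw [hnum, hm']
    push_cast at h1
    linarith

variable {𝔬 L} in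
/-- The additive valuation `v_P : L → ℚ ∪ {∞}` corresponding to the maximal ideal `P` of the
integral closure of `𝔬` in `L`, normalized by `v_P (Kˣ) = ℤ`. -/
noncomputable def normalizedValuation [Algebra.IsAlgebraic K L] (h𝔬 : ¬ IsField 𝔬)
    (P : MaximalSpectrum (integralClosure 𝔬 L)) : AddValuation L (WithTop ℚ) :=
  (exists_isNormalizedValuation K h𝔬 P).choose

variable {𝔬 L} in
theorem normalizedValuation_spec [Algebra.IsAlgebraic K L] (h𝔬 : ¬ IsField 𝔬)
    (P : MaximalSpectrum (integralClosure 𝔬 L)) :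
    IsNormalizedValuation K P (normalizedValuation K h𝔬 P) :=
  (exists_isNormalizedValuation K h𝔬 P).choose_spec

variable {𝔬 L} in
/-- The value group `v_P (Lˣ)`, as a subset of `ℝ`. -/
def valueSet [Algebra.IsAlgebraic K L] (h𝔬 : ¬ IsField 𝔬)
    (P : MaximalSpectrum (integralClosure 𝔬 L)) : Set ℝ :=
  {r | ∃ (x : Lˣ) (q : ℚ), normalizedValuation K h𝔬 P (x : L) = (q : WithTop ℚ) ∧ r = (q : ℝ)}

end Valuation

/-! ### Normalized valuations and fractional ideals -/

section

variable {𝔬 K L : Type*} [CommRing 𝔬] [Field K] [Field L] [Algebra K L] [Algebra 𝔬 L]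

/-! Regularity of a class is a statement about idempotent ideals. If `[I] = [I][J][I]`, then `I =
uIJI` with `u` principal, so `E = uIJ` is idempotent and satisfies `EI = I`. Once the only nonzero
idempotent fractional ideal is the unit ideal, `uJ` is an inverse of `I`. The converse is formal,
since Pic is a group.

The arithmetic therefore lies in excluding nontrivial idempotents, and it is done with the rank-one
valuations `v_P`. Powers of an element of `E` stay in `E` and share one denominator, so no value can
be negative; since 𝔒 is the intersection of its localizations at maximal ideals, `E` is an ideal of
𝔒 (`idempotent_fractionalIdeal_le_one`). If `E` lay in a maximal ideal `P`, its elements would have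
positive values at `P`. A value group that is closed in ℝ and contained in ℚ is cyclic, so those
values are at least some `ε > 0` (`exists_pos_le_normalizedValuation`). As `E` equals each of its
powers, they are at least every multiple of `ε`, whence `E = 0`. -/

theorem AddValuation.exists_eq_coe (v : AddValuation L (WithTop ℚ)) {x : L} (hx : x ≠ 0) :
    ∃ q : ℚ, v x = (q : WithTop ℚ) :=
  ⟨_, (WithTop.coe_untop _ (v.ne_top_iff.2 hx)).symm⟩

theorem AddValuation.map_inv_of_eq_coe (v : AddValuation L (WithTop ℚ)) {x : L} (hx : x ≠ 0)
    {q : ℚ} (h : v x = (q : WithTop ℚ)) : v x⁻¹ = ((-q : ℚ) : WithTop ℚ) := by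
  obtain ⟨r, hr⟩ := v.exists_eq_coe (inv_ne_zero hx)
  have h1 : v (x * x⁻¹) = 0 := by rw [mul_inv_cancel₀ hx, v.map_one]
  rw [v.map_mul, h, hr] at h1
  have h2 : q + r = 0 := by exact_mod_cast h1
  rw [hr, show r = -q by linarith]

/-- Elements of the maximal ideal `P` have positive value. -/
theorem IsNormalizedValuation.pos_of_mem {P : MaximalSpectrum (integralClosure 𝔬 L)}
    {v : AddValuation L (WithTop ℚ)} (hv : IsNormalizedValuation K P v)
    {x : integralClosure 𝔬 L} (hx : x ∈ P.asIdeal) : 0 < v (x : L) := by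
  by_cases hx0 : (x : L) = 0
  · rw [hx0, v.map_zero]; exact WithTop.coe_lt_top _
  obtain ⟨q, hq⟩ := v.exists_eq_coe hx0
  by_contra hle
  rw [hq] at hle
  have hq0 : q ≤ 0 := by
    rw [not_lt] at hle
    exact_mod_cast hle
  -- A nonpositive value would put `x⁻¹` in the localization at `P`; clearing its denominator `s`
  -- gives `s = a * x ∈ P`, contrary to `s ∉ P`.
  have hinv : 0 ≤ v (x : L)⁻¹ := by
    rw [v.map_inv_of_eq_coe hx0 hq]
    exact_mod_cast (neg_nonneg.2 hq0)
  obtain ⟨a, s, hs, h⟩ := (hv.nonneg_iff _).1 hinv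
  apply hs
  have : s = a * x := by
    apply Subtype.ext
    rw [MulMemClass.coe_mul, ← h]
    field_simp
  rw [this]
  exact P.asIdeal.mul_mem_left a hx

/-- An element of `L` with nonnegative values at all maximal ideals is integral. -/
theorem mem_integralClosure_of_forall_nonneg
    {v : MaximalSpectrum (integralClosure 𝔬 L) → AddValuation L (WithTop ℚ)}
    (hv : ∀ P, IsNormalizedValuation K P (v P)) {x : L} (hx : ∀ P, 0 ≤ v P x) :
    x ∈ integralClosure 𝔬 L := by
  -- `D` is the ideal of denominators of `x`. For each maximal ideal, membership of `x` in the
  -- localization supplies a denominator outside it, so `D` contains 1.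
  let D : Ideal (integralClosure 𝔬 L) :=
    { carrier := {s | x * (s : L) ∈ integralClosure 𝔬 L}
      zero_mem' := by simp [zero_mem]
      add_mem' := by
        intro a b ha hb
        change x * ((a + b : integralClosure 𝔬 L) : L) ∈ integralClosure 𝔬 L
        rw [AddMemClass.coe_add, mul_add]
        exact add_mem ha hb
      smul_mem' := by
        intro c a ha
        change x * ((c * a : integralClosure 𝔬 L) : L) ∈ integralClosure 𝔬 L
        rw [MulMemClass.coe_mul, mul_left_comm]
        exact mul_mem c.2 ha }
  have hD : D = ⊤ := by
    by_contra hne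
    obtain ⟨M, hM, hDM⟩ := D.exists_le_maximal hne
    obtain ⟨a, s, hs, h⟩ := ((hv ⟨M, hM⟩).nonneg_iff x).1 (hx ⟨M, hM⟩)
    refine hs (hDM ?_)
    change x * (s : L) ∈ integralClosure 𝔬 L
    rw [h]
    exact a.2
  have h1 : x * ((1 : integralClosure 𝔬 L) : L) ∈ integralClosure 𝔬 L :=
    (hD ▸ Submodule.mem_top : (1 : integralClosure 𝔬 L) ∈ D)
  simpa using h1

/-- An idempotent fractional ideal of the integral closure is contained in the unit ideal. -/
theorem idempotent_fractionalIdeal_le_one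
    {v : MaximalSpectrum (integralClosure 𝔬 L) → AddValuation L (WithTop ℚ)}
    (hv : ∀ P, IsNormalizedValuation K P (v P))
    {E : FractionalIdeal (integralClosure 𝔬 L)⁰ L} (hE : E * E = E) {x : L} (hx : x ∈ E) :
    x ∈ integralClosure 𝔬 L := by
  by_cases hx0 : x = 0
  · rw [hx0]; exact zero_mem _
  refine mem_integralClosure_of_forall_nonneg hv fun P => ?_
  -- The exponent starts at 1, because `x ^ 0 = 1` need not lie in `E`.
  have hpow : ∀ n : ℕ, x ^ (n + 1) ∈ E := by
    intro n
    induction n with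
    | zero => simpa using hx
    | succ n ih =>
      rw [pow_succ, ← hE]
      exact FractionalIdeal.mul_mem_mul ih hx
  obtain ⟨d, hd, hdE⟩ := E.isFractional
  have hd0 : (d : L) ≠ 0 := fun h => nonZeroDivisors.ne_zero hd (Subtype.ext h)
  obtain ⟨δ, hδ⟩ := (v P).exists_eq_coe hd0
  obtain ⟨q, hq⟩ := (v P).exists_eq_coe hx0
  -- The single denominator `d` serves all powers of `x`, so `δ` does not depend on `n`; by the
  -- Archimedean property this forces `q ≥ 0`.
  have hbound : ∀ n : ℕ, 0 ≤ δ + (n + 1) * q := by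
    intro n
    obtain ⟨a, ha⟩ := hdE _ (hpow n)
    have hnn : 0 ≤ v P ((d : L) * x ^ (n + 1)) := by
      refine ((hv P).nonneg_iff _).2 ⟨a, 1, ?_, ?_⟩
      · exact fun h => P.isMaximal.ne_top ((Ideal.eq_top_iff_one _).2 h)
      · rw [OneMemClass.coe_one, mul_one]
        exact ha.symm
    rw [(v P).map_mul, (v P).map_pow, hδ, hq, ← WithTop.coe_nsmul, ← WithTop.coe_add, nsmul_eq_mul] at hnn
    exact_mod_cast hnn
  rw [hq]
  by_contra hneg
  have hq0 : q < 0 := by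
    by_contra h
    exact hneg (by exact_mod_cast not_lt.1 h)
  obtain ⟨n, hn⟩ := exists_nat_gt (δ / (-q))
  rw [div_lt_iff₀ (by linarith)] at hn
  have := hbound n
  linarith

/-! ### Value groups closed in ℝ -/

variable [IsDedekindDomain 𝔬] [Algebra 𝔬 K] [IsFractionRing 𝔬 K] [IsScalarTower 𝔬 K L]
  [Algebra.IsAlgebraic K L]

/-- The value group of the normalized valuation, as an additive subgroup of `ℝ`. -/
def valueAddSubgroup (h𝔬 : ¬ IsField 𝔬) (P : MaximalSpectrum (integralClosure 𝔬 L)) :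
    AddSubgroup ℝ where
  carrier := valueSet K h𝔬 P
  zero_mem' := ⟨1, 0, by simp, by simp⟩
  add_mem' := by
    rintro _ _ ⟨x, q, hx, rfl⟩ ⟨y, r, hy, rfl⟩
    refine ⟨x * y, q + r, ?_, by push_cast; rfl⟩
    rw [Units.val_mul, AddValuation.map_mul, hx, hy, WithTop.coe_add]
  neg_mem' := by
    rintro _ ⟨x, q, hx, rfl⟩
    refine ⟨x⁻¹, -q, ?_, by push_cast; rfl⟩
    rw [Units.val_inv_eq_inv_val]
    exact AddValuation.map_inv_of_eq_coe _ x.ne_zero hx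

/-- If the value group is closed in `ℝ`, its positive elements are bounded away from zero. -/
theorem exists_pos_le_normalizedValuation (h𝔬 : ¬ IsField 𝔬)
    (P : MaximalSpectrum (integralClosure 𝔬 L))
    (hV : closure (valueSet K h𝔬 P) = valueSet K h𝔬 P) :
    ∃ ε : ℚ, 0 < ε ∧ ∀ x : L, 0 < normalizedValuation K h𝔬 P x →
      (ε : WithTop ℚ) ≤ normalizedValuation K h𝔬 P x := by
  -- A subgroup of ℝ is dense or cyclic. A dense closed one would be all of ℝ, but every value is
  -- rational, so √2 is missing.
  rcases AddSubgroup.dense_or_cyclic (valueAddSubgroup (K := K) h𝔬 P) with h | ⟨a, ha⟩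
  · have h2 : Real.sqrt 2 ∈ valueSet K h𝔬 P := by
      rw [← hV]
      exact h _
    obtain ⟨-, q, -, hq⟩ := h2
    exact absurd ⟨q, hq.symm⟩ irrational_sqrt_two
  · have hmem : ∀ r : ℝ, r ∈ valueSet K h𝔬 P ↔ ∃ n : ℤ, n • a = r := by
      intro r
      rw [← AddSubgroup.mem_closure_singleton, ← ha]
      rfl
    -- The generator is itself a value, hence a rational number `b`; this makes the bound `|b|`
    -- rational too.
    obtain ⟨-, b, -, rfl⟩ := (hmem a).2 ⟨1, one_zsmul a⟩
    have key : ∀ (x : L) (q : ℚ), 0 < q → normalizedValuation K h𝔬 P x = (q : WithTop ℚ) →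
        b ≠ 0 ∧ |b| ≤ q := by
      intro x q hq hx
      have hx0 : x ≠ 0 := by
        rintro rfl
        rw [AddValuation.map_zero] at hx
        exact WithTop.top_ne_coe hx
      obtain ⟨n, hn⟩ := (hmem q).1 ⟨Units.mk0 x hx0, q, hx, rfl⟩
      have hn' : (n : ℚ) * b = q := by
        rw [zsmul_eq_mul] at hn
        exact_mod_cast hn
      have hn0 : n ≠ 0 := by
        rintro rfl
        simp at hn'
        exact hq.ne hn'
      refine ⟨by rintro rfl; simp at hn'; exact hq.ne hn', ?_⟩
      have h1 : (1 : ℚ) ≤ |(n : ℚ)| := by exact_mod_cast Int.one_le_abs hn0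
      rw [← abs_of_pos hq, ← hn', abs_mul]
      exact le_mul_of_one_le_left (abs_nonneg b) h1
    refine ⟨if b = 0 then 1 else |b|, ?_, ?_⟩
    · split_ifs with hb
      · exact one_pos
      · exact abs_pos.2 hb
    · intro x hx
      by_cases hx0 : x = 0
      · rw [hx0, AddValuation.map_zero]; exact le_top
      obtain ⟨q, hq⟩ := (normalizedValuation K h𝔬 P).exists_eq_coe hx0
      rw [hq] at hx ⊢
      obtain ⟨hb, hbq⟩ := key x q (by exact_mod_cast hx) hq
      rw [if_neg hb]
      exact_mod_cast hbq

/-! ### Fractional ideals and ideal classes -/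

/-- If all value groups are closed in `ℝ`, the only nonzero idempotent fractional ideal of the
integral closure is the unit ideal. -/
theorem idempotent_fractionalIdeal_eq_one (h𝔬 : ¬ IsField 𝔬)
    (hV : ∀ P : MaximalSpectrum (integralClosure 𝔬 L),
      closure (valueSet K h𝔬 P) = valueSet K h𝔬 P)
    {E : FractionalIdeal (integralClosure 𝔬 L)⁰ L} (hE0 : E ≠ 0) (hE : E * E = E) : E = 1 := by
  obtain ⟨I, rfl⟩ : ∃ I : Ideal (integralClosure 𝔬 L),
      (I : FractionalIdeal (integralClosure 𝔬 L)⁰ L) = E := by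
    refine FractionalIdeal.le_one_iff_exists_coeIdeal.1 fun x hx => ?_
    exact (FractionalIdeal.mem_one_iff _).2
      ⟨⟨x, idempotent_fractionalIdeal_le_one (normalizedValuation_spec K h𝔬) hE hx⟩, rfl⟩
  suffices I = ⊤ by rw [this, FractionalIdeal.coeIdeal_top]
  by_contra hne
  obtain ⟨M, hM, hIM⟩ := I.exists_le_maximal hne
  let P : MaximalSpectrum (integralClosure 𝔬 L) := ⟨M, hM⟩
  obtain ⟨ε, hε, hmin⟩ := exists_pos_le_normalizedValuation h𝔬 P (hV P)
  set v := normalizedValuation K h𝔬 P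
  -- This uses that `I` is its own power with exponent `n + 1`: elements of `I = I * I` are sums of
  -- products, each further factor from `I ⊆ M` adds at least `ε`, and the ultrametric inequality
  -- handles sums.
  have hlow : ∀ (n : ℕ) (x : L), x ∈ (I : FractionalIdeal (integralClosure 𝔬 L)⁰ L) →
      (((n + 1) * ε : ℚ) : WithTop ℚ) ≤ v x := by
    intro n
    induction n with
    | zero =>
      intro x hx
      obtain ⟨y, hy, rfl⟩ := (FractionalIdeal.mem_coeIdeal _).1 hx
      simpa using hmin _ ((normalizedValuation_spec K h𝔬 P).pos_of_mem (hIM hy))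
    | succ n ih =>
      intro x hx
      rw [← hE] at hx
      refine FractionalIdeal.mul_induction_on hx ?_ ?_
      · intro y hy z hz
        obtain ⟨w, hw, rfl⟩ := (FractionalIdeal.mem_coeIdeal _).1 hz
        have h2 := hmin _ ((normalizedValuation_spec K h𝔬 P).pos_of_mem (hIM hw))
        rw [v.map_mul]
        refine le_trans (le_of_eq ?_) (add_le_add (ih y hy) h2)
        rw [← WithTop.coe_add]
        congr 1
        push_cast
        ring
      · intro y z hy hz
        exact (le_min hy hz).trans (v.map_add y z)
  apply hE0
  refine FractionalIdeal.eq_zero_iff.2 fun x hx => ?_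
  by_contra hx0
  -- A nonzero element has a finite value, which cannot exceed all multiples of `ε`.
  obtain ⟨q, hq⟩ := v.exists_eq_coe hx0
  obtain ⟨n, hn⟩ := exists_nat_gt (q / ε)
  rw [div_lt_iff₀ hε] at hn
  have h := hlow n x hx
  rw [hq] at h
  have h' : (n + 1) * ε ≤ q := by exact_mod_cast h
  linarith

end

/-- Both quotients are taken by the same principal ideals: two invertible ideals with equal class in
Cl differ by a principal factor, and that equation already holds in the unit group. -/
theorem picardToClass_injective (R L : Type*) [CommRing R] [IsDomain R] [Field L] [Algebra R L] :
    Function.Injective (picardToClass R L) := by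
  intro a b
  refine QuotientGroup.induction_on a fun u => QuotientGroup.induction_on b fun w h => ?_
  obtain ⟨p, hp, hpw⟩ := (Con.eq (idealClassCon R L)).1 h
  have hu : u = p * w := Units.ext hpw
  refine (QuotientGroup.eq).2 ?_
  have : u⁻¹ * w = p⁻¹ := by rw [hu, mul_inv_rev, mul_right_comm, inv_mul_cancel, one_mul]
  rw [this]
  exact inv_mem hp

/-- If the unit ideal is the only nonzero idempotent fractional ideal, the regular ideal classes
are the classes of the invertible fractional ideals. -/
theorem regularPart_eq_range_picardToClass (R L : Type*) [CommRing R] [IsDomain R] [Field L]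
    [Algebra R L] (h : ∀ E : FractionalIdeal R⁰ L, E ≠ 0 → E * E = E → E = 1) :
    regularPart (IdealClassSemigroup R L) = Set.range (picardToClass R L) := by
  ext c
  constructor
  · rintro ⟨b, hb⟩
    induction c using Con.induction_on with | _ I =>
    induction b using Con.induction_on with | _ J =>
    obtain ⟨u, -, hI⟩ := (Con.eq (idealClassCon R L)).1 hb
    rw [Submonoid.coe_mul, Submonoid.coe_mul] at hI
    set I' : FractionalIdeal R⁰ L := I.1
    set J' : FractionalIdeal R⁰ L := J.1
    have hEI : (u * (I' * J')) * I' = I' := by rw [mul_assoc]; exact hI.symm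
    -- Multiplying `E * I' = I'` by `u * J'` shows that `E = u * (I' * J')` is idempotent.
    have hE : (u * (I' * J')) * (u * (I' * J')) = u * (I' * J') := by
      calc (u * (I' * J')) * (u * (I' * J')) = u * ((u * (I' * J')) * I') * J' := by ring
        _ = u * (I' * J') := by rw [hEI, mul_assoc]
    have hI0 : I' ≠ 0 := I.2
    have h1 := h _ (fun h0 => hI0 (by rw [← hEI, h0, zero_mul])) hE
    -- Now `E = 1` reads `I' * (u * J') = 1`, which exhibits the inverse of `I'`.
    refine ⟨QuotientGroup.mk (Units.mkOfMulEqOne I' (u * J') (by rw [← h1]; ring)), ?_⟩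
    rfl
  · rintro ⟨a, rfl⟩
    -- A homomorphism carries the group identity `a = a * a⁻¹ * a` to regularity of the image.
    exact ⟨picardToClass R L a⁻¹, by rw [← map_mul, ← map_mul, mul_inv_cancel, one_mul]⟩

theorem corollary2p7 {𝔬 K L : Type*} [CommRing 𝔬] [IsDedekindDomain 𝔬] (h𝔬 : ¬ IsField 𝔬)
    [Field K] [Algebra 𝔬 K] [IsFractionRing 𝔬 K]
    [Field L] [Algebra K L] [Algebra.IsAlgebraic K L] [Algebra 𝔬 L] [IsScalarTower 𝔬 K L]
    (hV : ∀ P : MaximalSpectrum (integralClosure 𝔬 L),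
      closure (valueSet K h𝔬 P) = valueSet K h𝔬 P) :
    Function.Injective (picardToClass (integralClosure 𝔬 L) L) ∧
      regularPart (IdealClassSemigroup (integralClosure 𝔬 L) L) =
        Set.range (picardToClass (integralClosure 𝔬 L) L) :=
  ⟨picardToClass_injective _ _, regularPart_eq_range_picardToClass _ _
    fun _ hE0 hE => idempotent_fractionalIdeal_eq_one h𝔬 hV hE0 hE⟩
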